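/- Let $A$ be the alternating Kurepa function: for $\operatorname{Re} z>0$, $$A(z)=\int_0^\infty e^{-t}\,\frac{t^{z+1}-(-1)^z t}{t+1}\,dt,\qquad (-1)^z=e^{i\pi z},$$ continued to $\operatorname{Re} z\le 0$, $z\ne -2,-3,\dots$, by means of the functional equation $A(z-1)=\Gamma(z+1)-A(z)$. For every real $x>-2$ the integrals $$\beta(x)=\int_0^\infty e^{-t}\,\frac{t^{x+1}}{t+1}\,dt,\qquad \gamma(x)=\int_0^\infty e^{-t}\,\frac{\cos(\pi x)\,t}{t+1}\,dt$$ converge and $$\operatorname{Re}A(x)=\beta(x)-\gamma(x).$$ On $(-2,\infty)$ the function $\operatorname{Re}A$ has exactly two roots, $x_1=-0.015401\ldots$ (that is, $-0.015402<x_1\le -0.015401$) and $x_2=0$. It is positive on $(-2,x_1)\cup(0,\infty)$ and negative on $(x_1,0)$. -/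

import Mathlib

open MeasureTheory Set

noncomputable section

/-- The integrand `e^{-t} (t^{z+1} - (-1)^z t) / (t+1)`. The powers are principal ones, so
`(-1)^z = exp (i π z)`. -/
def kurepaIntegrand (z : ℂ) (t : ℝ) : ℂ :=
  Complex.exp (-(t : ℂ)) * (((t : ℂ) ^ (z + 1) - (-1 : ℂ) ^ z * (t : ℂ)) / ((t : ℂ) + 1))

/-- The integral `∫₀^∞ e^{-t} (t^{z+1} - (-1)^z t) / (t+1) dt`, which defines the alternating
Kurepa function for `0 < Re z`. -/
def kurepaIntegral (z : ℂ) : ℂ := ∫ t in Ioi (0 : ℝ), kurepaIntegrand z t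

/-- `n` steps of the continuation to the left by `A(z-1) = Γ(z+1) - A(z)`, that is
`A(z) = Γ(z+2) - A(z+1)`, starting from the integral at `z + n`. -/
def kurepaStep : ℕ → ℂ → ℂ
  | 0, z => kurepaIntegral z
  | n + 1, z => Complex.Gamma (z + 2) - kurepaStep n (z + 1)

/-- The alternating Kurepa function: the integral for `0 < Re z`, continued to `Re z ≤ 0` by
the functional equation. The number `⌊1 - Re z⌋₊` of steps is the least `n : ℕ` with
`0 < Re z + n`; in particular it is `0` if `0 < Re z`. (At the poles `-2, -3, …` the value
carries no meaning.) -/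
def alternatingKurepa (z : ℂ) : ℂ := kurepaStep ⌊1 - z.re⌋₊ z

/-- The integrand `e^{-t} t^{x+1} / (t+1)` of `β(x)`. -/
def betaIntegrand (x t : ℝ) : ℝ := Real.exp (-t) * (t ^ (x + 1) / (t + 1))

/-- `β(x) = ∫₀^∞ e^{-t} t^{x+1} / (t+1) dt`. -/
def kurepaBeta (x : ℝ) : ℝ := ∫ t in Ioi (0 : ℝ), betaIntegrand x t

/-- The integrand `e^{-t} cos(πx) t / (t+1)` of `γ(x)`. -/
def gammaIntegrand (x t : ℝ) : ℝ := Real.exp (-t) * (Real.cos (Real.pi * x) * t / (t + 1))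

/-- `γ(x) = ∫₀^∞ e^{-t} cos(πx) t / (t+1) dt`. -/
def kurepaGamma (x : ℝ) : ℝ := ∫ t in Ioi (0 : ℝ), gammaIntegrand x t

end

/-!
On the real axis `Re A = β - γ` with `γ x = cos (πx) β 0`: this is the definition for `x > 0`, and
both sides satisfy the same functional equation, because `β x + β (x + 1) = Γ(x + 2)` and
`γ (x + 1) = -γ x` (`re_kurepaStep`).

The sign of `β - γ` comes from convexity. As an average of the functions `x ↦ t ^ (x + 1)`, `β` is
convex and positive. On `[-1/2, 1/2]` the function `-γ` is strictly convex, so `β - γ` has at most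
two zeros there, is negative between them and positive outside. Where `1/2 ≤ |x| ≤ 1` the cosine is
nonpositive, so `β - γ` is positive. For `|x| ≥ 1` convexity gives `β x > β 0 ≥ γ x`, since
`β (-1) = β 1 = 1 - β 0 > β 0`. One zero is `0`; what remains is to see that `β - γ` is positive at
`-0.015402` and negative at `-0.015401`, where its values are about `2.1e-8` and `-1.2e-8`.

For these two values (`beta_sub_gamma_leftEndpoint_pos`, `beta_sub_gamma_rightEndpoint_neg`),
`β (s - 2) / Γ(s)` is enclosed by the truncations of its Stieltjes continued fraction
(`tricomiFraction_bounds`), which needs only the contiguous relations of the integrals `∫ e^{-t} t^{a-1} / (t+1)^k dt`. Near `2` the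
function `Γ` is enclosed by correcting Euler's limit formula with the first three terms of its
asymptotic expansion, which turns it into a monotone sequence
(`logGammaApprox_add_correction_le`, `le_logGammaApprox_add_correction`).
-/

/-! ### The integrals `∫₀^∞ e^{-t} t^{a-1} / (t+1)^k dt` -/

/-- The integral `∫₀^∞ e^{-t} t^{a-1} / (t+1)^k dt`. It is `Γ(a)` for `k = 0` and `β(a-2)` for
`k = 1`; up to the factor `Γ(a)` it is a confluent hypergeometric function of the second kind. -/
noncomputable def tricomiIntegral (a : ℝ) (k : ℕ) : ℝ :=
  ∫ t in Ioi (0 : ℝ), Real.exp (-t) * t ^ (a - 1) / (t + 1) ^ k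

theorem integrableOn_tricomi {a : ℝ} (ha : 0 < a) (k : ℕ) :
    IntegrableOn (fun t : ℝ => Real.exp (-t) * t ^ (a - 1) / (t + 1) ^ k) (Ioi 0) := by
  refine (Real.GammaIntegral_convergent ha).mono' ?_ ?_
  · refine ContinuousOn.aestronglyMeasurable (fun t ht => ?_) measurableSet_Ioi
    have ht : 0 < t := ht
    refine ContinuousAt.continuousWithinAt ?_
    refine ContinuousAt.div ?_ (by fun_prop) (by positivity)
    exact ContinuousAt.mul (by fun_prop) (Real.continuousAt_rpow_const _ _ (Or.inl ht.ne'))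
  · filter_upwards [ae_restrict_mem measurableSet_Ioi] with t ht
    have ht : 0 < t := ht
    rw [Real.norm_of_nonneg (by positivity)]
    exact div_le_self (by positivity) (one_le_pow₀ (by linarith))

theorem tricomiIntegral_zero_right {a : ℝ} (ha : 0 < a) : tricomiIntegral a 0 = Real.Gamma a := by
  simp [tricomiIntegral, Real.Gamma_eq_integral ha]

theorem tricomiIntegral_pos {a : ℝ} (ha : 0 < a) (k : ℕ) : 0 < tricomiIntegral a k := by
  refine (setIntegral_pos_iff_support_of_nonneg_ae ?_ (integrableOn_tricomi ha k)).2 ?_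
  · filter_upwards [ae_restrict_mem measurableSet_Ioi] with t ht
    have ht : 0 < t := ht
    simp only [Pi.zero_apply]; positivity
  · have : Ioi (0 : ℝ) ⊆ (Function.support fun t : ℝ =>
        Real.exp (-t) * t ^ (a - 1) / (t + 1) ^ k) ∩ Ioi 0 := fun t ht => by
      have h : 0 < t := ht
      exact ⟨(by positivity : (0 : ℝ) < Real.exp (-t) * t ^ (a - 1) / (t + 1) ^ k).ne', ht⟩
    exact lt_of_lt_of_le (by simp) (measure_mono this)

/-- Splitting `1 = (1 + t) / (1 + t)` under the integral sign. -/
theorem tricomiIntegral_eq_add {a : ℝ} (ha : 0 < a) (k : ℕ) :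
    tricomiIntegral a k = tricomiIntegral a (k + 1) + tricomiIntegral (a + 1) (k + 1) := by
  unfold tricomiIntegral
  rw [← integral_add (integrableOn_tricomi ha _) (integrableOn_tricomi (by linarith) _)]
  refine setIntegral_congr_fun measurableSet_Ioi fun t ht => ?_
  have ht : 0 < t := ht
  have h : t ^ (a + 1 - 1) = t ^ (a - 1) * t := by
    rw [show a + 1 - 1 = a - 1 + 1 by ring, Real.rpow_add_one ht.ne']
  simp only [h]
  field_simp
  ring

/-- Integration by parts against `d(t ^ a)`. -/
theorem mul_tricomiIntegral {a : ℝ} (ha : 0 < a) (k : ℕ) :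
    a * tricomiIntegral a k
      = tricomiIntegral (a + 1) k + k * tricomiIntegral (a + 1) (k + 1) := by
  have ha1 : 0 < a + 1 := by linarith
  set f : ℝ → ℝ := fun t => Real.exp (-t) * t ^ a / (t + 1) ^ k with hf
  set f' : ℝ → ℝ := fun t => a * (Real.exp (-t) * t ^ (a - 1) / (t + 1) ^ k)
    - (Real.exp (-t) * t ^ (a + 1 - 1) / (t + 1) ^ k
      + k * (Real.exp (-t) * t ^ (a + 1 - 1) / (t + 1) ^ (k + 1))) with hf'
  have hA := (integrableOn_tricomi ha k).const_mul a
  have hB := integrableOn_tricomi ha1 k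
  have hC := (integrableOn_tricomi ha1 (k + 1)).const_mul (k : ℝ)
  have hint : IntegrableOn f' (Ioi 0) := hA.sub (hB.add hC)
  have hderiv : ∀ t ∈ Ioi (0 : ℝ), HasDerivAt f (f' t) t := fun t ht => by
    have ht : 0 < t := ht
    have h1 : HasDerivAt (fun t : ℝ => Real.exp (-t)) (-Real.exp (-t)) t := by
      simpa using (hasDerivAt_neg t).exp
    have h2 : HasDerivAt (fun t : ℝ => t ^ a) (a * t ^ (a - 1)) t :=
      Real.hasDerivAt_rpow_const (Or.inl ht.ne')
    have h3 : HasDerivAt (fun t : ℝ => (t + 1) ^ k) (k * (t + 1) ^ (k - 1)) t := by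
      simpa using ((hasDerivAt_id t).add_const 1).fun_pow k
    have h := (h1.mul h2).div h3 (by positivity)
    refine h.congr_deriv ?_
    have h4 : (k : ℝ) * (t + 1) ^ (k - 1) = k * ((t + 1) ^ k / (t + 1)) := by
      rcases k with _ | k
      · simp
      · have : t + 1 ≠ 0 := by positivity
        rw [Nat.add_sub_cancel, pow_succ]; field_simp
    simp only [hf', Pi.mul_apply, h4, show a + 1 - 1 = a by ring]
    field_simp
    ring
  have hcont : ContinuousWithinAt f (Ici 0) 0 := by
    refine ContinuousAt.continuousWithinAt ?_
    refine ContinuousAt.div ?_ (by fun_prop) (by simp)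
    exact ContinuousAt.mul (by fun_prop) (Real.continuousAt_rpow_const _ _ (Or.inr ha.le))
  have htend : Filter.Tendsto f Filter.atTop (nhds 0) := by
    refine squeeze_zero' (g := fun t : ℝ => t ^ a * Real.exp (-t)) ?_ ?_ ?_
    · filter_upwards [Filter.eventually_gt_atTop 0] with t ht
      simp only [hf]; positivity
    · filter_upwards [Filter.eventually_gt_atTop 0] with t ht
      rw [mul_comm]
      exact div_le_self (by positivity) (one_le_pow₀ (by linarith))
    · simpa using tendsto_rpow_mul_exp_neg_mul_atTop_nhds_zero a 1 one_pos
  have h := integral_Ioi_of_hasDerivAt_of_tendsto hcont hderiv hint htend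
  have h0 : f 0 = 0 := by simp [hf, Real.zero_rpow ha.ne']
  have e : ∫ t in Ioi (0 : ℝ), f' t = a * tricomiIntegral a k
      - (tricomiIntegral (a + 1) k + k * tricomiIntegral (a + 1) (k + 1)) := by
    simp only [hf', tricomiIntegral]
    rw [integral_sub hA (by exact hB.add hC), integral_add hB hC,
      integral_const_mul, integral_const_mul]
  linarith

/-! ### The continued fraction of the first integral -/

/-- The last `n` levels, starting at level `k`, of the Stieltjes continued fraction
`1/(1 + s/(1 + 1/(1 + (s+1)/(1 + 2/(1 + ⋯)))))` with tail `v`; a level holds two partial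
quotients. -/
noncomputable def tricomiFraction (s v : ℝ) : ℕ → ℕ → ℝ
  | 0, _ => v
  | n + 1, k => 1 / (1 + (s + k) / (1 + (k + 1) * tricomiFraction s v n (k + 1)))

theorem tricomiIntegral_ratio_step {s : ℝ} (hs : 0 < s) (k : ℕ) :
    tricomiIntegral (s + k) (k + 1) / tricomiIntegral (s + k) k
      = 1 / (1 + (s + k) / (1 + (k + 1) *
          (tricomiIntegral (s + (k + 1 : ℕ)) (k + 1 + 1)
            / tricomiIntegral (s + (k + 1 : ℕ)) (k + 1)))) := by
  have hsk : 0 < s + k := by positivity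
  have h1 := tricomiIntegral_eq_add hsk k
  have h2 := mul_tricomiIntegral hsk (k + 1)
  have e : s + ((k + 1 : ℕ) : ℝ) = s + k + 1 := by push_cast; ring
  rw [e]
  push_cast at h2
  have p1 := tricomiIntegral_pos hsk (k + 1)
  have p2 := tricomiIntegral_pos (by linarith : 0 < s + k + 1) (k + 1)
  have p3 := tricomiIntegral_pos (by linarith : 0 < s + k + 1) (k + 1 + 1)
  rw [h1]
  have q : 0 < tricomiIntegral (s + k + 1) (k + 1)
      + (k + 1) * tricomiIntegral (s + k + 1) (k + 1 + 1) := by positivity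
  have r : (s + k) / (1 + ((k : ℝ) + 1) * (tricomiIntegral (s + k + 1) (k + 1 + 1)
      / tricomiIntegral (s + k + 1) (k + 1)))
      = tricomiIntegral (s + k + 1) (k + 1) / tricomiIntegral (s + k) (k + 1) := by
    rw [eq_div_iff p1.ne', div_mul_eq_mul_div, h2]
    field_simp
  rw [r]
  field_simp

/-- The tails of the continued fraction lie in `[0, 1]`, and every level is increasing in its tail,
so the truncations with tails `0` and `1` enclose the value. -/
theorem tricomiFraction_bounds {s : ℝ} (hs : 0 < s) (n k : ℕ) :
    0 ≤ tricomiFraction s 0 n k ∧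
    tricomiFraction s 0 n k ≤ tricomiIntegral (s + k) (k + 1) / tricomiIntegral (s + k) k ∧
    tricomiIntegral (s + k) (k + 1) / tricomiIntegral (s + k) k ≤ tricomiFraction s 1 n k := by
  induction n generalizing k with
  | zero =>
    have hsk : 0 < s + k := by positivity
    have p1 := tricomiIntegral_pos hsk (k + 1)
    have p2 := tricomiIntegral_pos hsk k
    have p3 := tricomiIntegral_pos (by linarith : 0 < s + k + 1) (k + 1)
    refine ⟨le_rfl, (div_pos p1 p2).le, ?_⟩
    rw [tricomiFraction, div_le_one p2, tricomiIntegral_eq_add hsk k]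
    linarith
  | succ n ih =>
    obtain ⟨h0, h1, h2⟩ := ih (k + 1)
    have hsk : 0 < s + k := by positivity
    rw [tricomiIntegral_ratio_step hs k, tricomiFraction, tricomiFraction]
    have h3 := h0.trans h1
    have h4 := h3.trans h2
    refine ⟨by positivity, ?_, ?_⟩ <;> gcongr

theorem gamma_mul_tricomiFraction_le {s : ℝ} (hs : 0 < s) (n : ℕ) :
    Real.Gamma s * tricomiFraction s 0 n 0 ≤ tricomiIntegral s 1 := by
  have h := (tricomiFraction_bounds hs n 0).2.1
  have hg := Real.Gamma_pos_of_pos hs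
  simp only [Nat.cast_zero, add_zero, zero_add, tricomiIntegral_zero_right hs] at h
  rwa [le_div_iff₀ hg, mul_comm] at h

theorem le_gamma_mul_tricomiFraction {s : ℝ} (hs : 0 < s) (n : ℕ) :
    tricomiIntegral s 1 ≤ Real.Gamma s * tricomiFraction s 1 n 0 := by
  have h := (tricomiFraction_bounds hs n 0).2.2
  have hg := Real.Gamma_pos_of_pos hs
  simp only [Nat.cast_zero, add_zero, zero_add, tricomiIntegral_zero_right hs] at h
  rwa [div_le_iff₀ hg, mul_comm] at h

/-! ### The real part of `A` on the real axis -/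

theorem betaIntegrand_eq (x t : ℝ) :
    betaIntegrand x t = Real.exp (-t) * t ^ ((x + 2) - 1) / (t + 1) ^ 1 := by
  rw [betaIntegrand, show x + 2 - 1 = x + 1 by ring]; ring

theorem gammaIntegrand_eq (x t : ℝ) : gammaIntegrand x t
    = Real.cos (Real.pi * x) * (Real.exp (-t) * t ^ ((2 : ℝ) - 1) / (t + 1) ^ 1) := by
  rw [gammaIntegrand, show (2 : ℝ) - 1 = 1 by norm_num, Real.rpow_one]; ring

theorem integrableOn_betaIntegrand {x : ℝ} (hx : -2 < x) :
    IntegrableOn (betaIntegrand x) (Ioi 0) := by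
  rw [funext (betaIntegrand_eq x)]
  exact integrableOn_tricomi (by linarith) 1

theorem integrableOn_gammaIntegrand (x : ℝ) : IntegrableOn (gammaIntegrand x) (Ioi 0) := by
  rw [funext (gammaIntegrand_eq x)]
  exact (integrableOn_tricomi two_pos 1).const_mul _

theorem kurepaBeta_eq (x : ℝ) : kurepaBeta x = tricomiIntegral (x + 2) 1 := by
  simp only [kurepaBeta, tricomiIntegral, betaIntegrand_eq]

theorem kurepaBeta_pos {x : ℝ} (hx : -2 < x) : 0 < kurepaBeta x := by
  rw [kurepaBeta_eq]; exact tricomiIntegral_pos (by linarith) 1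

theorem kurepaGamma_eq (x : ℝ) : kurepaGamma x = Real.cos (Real.pi * x) * kurepaBeta 0 := by
  rw [kurepaBeta_eq, zero_add]
  simp only [kurepaGamma, tricomiIntegral, gammaIntegrand_eq, integral_const_mul]

/-- The real form of the functional equation. -/
theorem kurepaBeta_add_kurepaBeta_add_one {x : ℝ} (hx : -2 < x) :
    kurepaBeta x + kurepaBeta (x + 1) = Real.Gamma (x + 2) := by
  have h : 0 < x + 2 := by linarith
  rw [kurepaBeta_eq, kurepaBeta_eq, ← tricomiIntegral_zero_right h,
    tricomiIntegral_eq_add h 0, show x + 1 + 2 = x + 2 + 1 by ring]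

theorem kurepaGamma_add_one (x : ℝ) : kurepaGamma (x + 1) = -kurepaGamma x := by
  rw [kurepaGamma_eq, kurepaGamma_eq, mul_add, mul_one, Real.cos_add_pi, neg_mul]

theorem re_neg_one_cpow (x : ℝ) : ((-1 : ℂ) ^ (x : ℂ)).re = Real.cos (Real.pi * x) := by
  rw [Complex.cpow_def_of_ne_zero (by norm_num), Complex.log_neg_one,
    show (Real.pi : ℂ) * Complex.I * x = ((Real.pi * x : ℝ) : ℂ) * Complex.I by push_cast; ring,
    Complex.exp_ofReal_mul_I_re]

theorem kurepaIntegral_ofReal {x : ℝ} (hx : -2 < x) :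
    kurepaIntegral x = kurepaBeta x - (-1 : ℂ) ^ (x : ℂ) * kurepaBeta 0 := by
  have h1 : IntegrableOn (fun t => ((betaIntegrand x t : ℝ) : ℂ)) (Ioi 0) :=
    (integrableOn_betaIntegrand hx).ofReal
  have h2 : IntegrableOn (fun t => (-1 : ℂ) ^ (x : ℂ) * ((betaIntegrand 0 t : ℝ) : ℂ)) (Ioi 0) :=
    (integrableOn_betaIntegrand (by norm_num)).ofReal.const_mul _
  calc kurepaIntegral x
      = ∫ t in Ioi (0 : ℝ), (((betaIntegrand x t : ℝ) : ℂ)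
          - (-1 : ℂ) ^ (x : ℂ) * ((betaIntegrand 0 t : ℝ) : ℂ)) := by
        refine setIntegral_congr_fun measurableSet_Ioi fun t ht => ?_
        have ht : 0 < t := ht
        simp only [kurepaIntegrand, betaIntegrand, zero_add, Real.rpow_one]
        push_cast [Complex.ofReal_cpow ht.le]
        ring
    _ = _ := by
        rw [integral_sub h1 h2, integral_const_mul, integral_complex_ofReal,
          integral_complex_ofReal, kurepaBeta, kurepaBeta]

/-- The integral formula holds in the whole range `-2 < x` after any number of continuation
steps: both sides obey the same functional equation. -/
theorem re_kurepaStep (n : ℕ) {x : ℝ} (hx : -2 < x) :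
    (kurepaStep n x).re = kurepaBeta x - kurepaGamma x := by
  induction n generalizing x with
  | zero =>
    rw [kurepaStep, kurepaIntegral_ofReal hx, Complex.sub_re, Complex.re_mul_ofReal,
      re_neg_one_cpow, Complex.ofReal_re, kurepaGamma_eq]
  | succ n ih =>
    have h := ih (x := x + 1) (by linarith)
    push_cast at h
    rw [kurepaStep, Complex.sub_re, h, kurepaGamma_add_one,
      show (x : ℂ) + 2 = ((x + 2 : ℝ) : ℂ) by push_cast; ring, Complex.Gamma_ofReal,
      Complex.ofReal_re, ← kurepaBeta_add_kurepaBeta_add_one hx]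
    ring

theorem re_alternatingKurepa {x : ℝ} (hx : -2 < x) :
    (alternatingKurepa x).re = kurepaBeta x - kurepaGamma x :=
  re_kurepaStep _ hx

/-! ### Convexity of `β` -/

/-- `x ↦ t ^ (x + 1)` is convex for every `t > 0`, hence so is its average `β`. -/
theorem convexOn_kurepaBeta : ConvexOn ℝ (Ioi (-2)) kurepaBeta := by
  refine ⟨convex_Ioi _, fun x hx y hy a b ha hb hab => ?_⟩
  have hx : -2 < x := hx
  have hy : -2 < y := hy
  have hxy : -2 < a • x + b • y := (convex_Ioi (-2 : ℝ)) hx hy ha hb hab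
  have ix := (integrableOn_betaIntegrand hx).const_mul a
  have iy := (integrableOn_betaIntegrand hy).const_mul b
  simp only [smul_eq_mul] at hxy ⊢
  unfold kurepaBeta
  rw [← integral_const_mul, ← integral_const_mul, ← integral_add ix iy]
  refine setIntegral_mono_on (integrableOn_betaIntegrand hxy) (ix.add iy) measurableSet_Ioi
    fun t ht => ?_
  have ht : 0 < t := ht
  have h := convexOn_exp.2 (mem_univ (Real.log t * (x + 1))) (mem_univ (Real.log t * (y + 1)))
    ha hb hab
  simp only [smul_eq_mul] at h
  have e : a * (Real.log t * (x + 1)) + b * (Real.log t * (y + 1))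
      = Real.log t * (a * x + b * y + 1) := by
    linear_combination Real.log t * hab
  rw [e] at h
  simp only [betaIntegrand, Real.rpow_def_of_pos ht]
  have hc : 0 ≤ Real.exp (-t) / (t + 1) := by positivity
  calc Real.exp (-t) * (Real.exp (Real.log t * (a * x + b * y + 1)) / (t + 1))
      = Real.exp (-t) / (t + 1) * Real.exp (Real.log t * (a * x + b * y + 1)) := by ring
    _ ≤ Real.exp (-t) / (t + 1) * (a * Real.exp (Real.log t * (x + 1))
          + b * Real.exp (Real.log t * (y + 1))) := mul_le_mul_of_nonneg_left h hc
    _ = _ := by ring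

/-- On `[-1/2, 1/2]`, where `cos (πx)` is concave, the strictness comes from `γ` alone. -/
theorem strictConvexOn_beta_sub_gamma :
    StrictConvexOn ℝ (Icc (-(1 / 2)) (1 / 2)) fun x => kurepaBeta x - kurepaGamma x := by
  have h1 : ConvexOn ℝ (Icc (-(1 / 2) : ℝ) (1 / 2)) kurepaBeta :=
    convexOn_kurepaBeta.subset (fun x hx => by have := hx.1; simp only [mem_Ioi]; linarith)
      (convex_Icc _ _)
  have hC : 0 < kurepaBeta 0 := kurepaBeta_pos (by norm_num)
  have h2 : StrictConvexOn ℝ (Icc (-(1 / 2) : ℝ) (1 / 2)) fun x => -kurepaGamma x := by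
    refine ⟨convex_Icc _ _, fun x hx y hy hxy a b ha hb hab => ?_⟩
    have hpi := Real.pi_pos
    have mem : ∀ z ∈ Icc (-(1 / 2) : ℝ) (1 / 2), Real.pi * z ∈ Icc (-(Real.pi / 2)) (Real.pi / 2) :=
      fun z hz => ⟨by nlinarith [hz.1], by nlinarith [hz.2]⟩
    have h := strictConcaveOn_cos_Icc.2 (mem x hx) (mem y hy)
      (fun h => hxy (mul_left_cancel₀ hpi.ne' h)) ha hb hab
    simp only [smul_eq_mul, kurepaGamma_eq] at h ⊢
    rw [show a * (Real.pi * x) + b * (Real.pi * y) = Real.pi * (a * x + b * y) by ring] at h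
    nlinarith
  have e : (fun x => kurepaBeta x - kurepaGamma x) = kurepaBeta + fun x => -kurepaGamma x :=
    funext fun x => sub_eq_add_neg _ _
  rw [e]
  exact h1.add_strictConvexOn h2

/-! ### Enclosing `Γ` by its asymptotic expansion -/

/-- The logarithm of `n^(a-1) n! / (a (a+1) ⋯ (a+n-1))`, which tends to `log Γ(a)`. -/
noncomputable def logGammaApprox (a : ℝ) (n : ℕ) : ℝ :=
  (a - 1) * Real.log n + Real.log n.factorial - ∑ m ∈ Finset.range n, Real.log (a + m)

/-- The asymptotic expansion of `log Γ(a) - logGammaApprox a n` to third order in `1 / n`, with its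
last coefficient perturbed by `δ`. -/
noncomputable def logGammaCorrection (a δ n : ℝ) : ℝ :=
  a * (1 - a) * (-(1 / 2) / n + (2 * a - 1) / 12 / n ^ 2 + (a * (1 - a) / 12 + δ) / n ^ 3)

/-- The increment from `n` to `n + 1` of `logGammaApprox + logGammaCorrection`, in terms of
`u = 1 / n`. -/
noncomputable def logGammaIncrement (a δ u : ℝ) : ℝ :=
  a * Real.log (1 + u) - Real.log (1 + a * u)
    + a * (1 - a) * (-(1 / 2) * (u / (1 + u) - u) + (2 * a - 1) / 12 * ((u / (1 + u)) ^ 2 - u ^ 2)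
      + (a * (1 - a) / 12 + δ) * ((u / (1 + u)) ^ 3 - u ^ 3))

/-- The factor of the derivative of `logGammaIncrement` that decides its sign. Without the
perturbation `δ` it is `-u ^ 3 / 6` to leading order as `a → 1`; the perturbation contributes
`-12 * δ * u ^ 2`. -/
noncomputable def logGammaIncrementFactor (a δ u : ℝ) : ℝ :=
  -(1 + u) ^ 3 + ((2 + u) * (1 + u) ^ 2 / 2 + (2 * a - 1) / 12 * (2 * (1 + u) - 2 * (1 + u) ^ 4)
    + (a * (1 - a) / 12 + δ) * (3 * u - 3 * u * (1 + u) ^ 4)) * (1 + a * u)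

theorem hasDerivAt_logGammaIncrement {a δ u : ℝ} (ha : 0 < a) (hu : 0 ≤ u) :
    HasDerivAt (logGammaIncrement a δ)
      (a * (1 - a) * u * logGammaIncrementFactor a δ u / ((1 + u) ^ 4 * (1 + a * u))) u := by
  have h1 : HasDerivAt (fun u : ℝ => 1 + u) 1 u := (hasDerivAt_id u).const_add 1
  have h2 : HasDerivAt (fun u : ℝ => 1 + a * u) a u := by
    simpa using ((hasDerivAt_id u).const_mul a).const_add 1
  have p1 : 1 + u ≠ 0 := by positivity
  have p2 : 1 + a * u ≠ 0 := by positivity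
  have h3 := (hasDerivAt_id u).div h1 p1
  have h4 := ((h1.log p1).const_mul a).sub (h2.log p2)
  have h5 := h4.add ((((h3.sub (hasDerivAt_id u)).const_mul (-(1 / 2))).add
    (((h3.fun_pow 2).sub ((hasDerivAt_id u).fun_pow 2)).const_mul ((2 * a - 1) / 12))).add
    (((h3.fun_pow 3).sub ((hasDerivAt_id u).fun_pow 3)).const_mul (a * (1 - a) / 12 + δ))
      |>.const_mul (a * (1 - a)))
  refine h5.congr_deriv ?_
  simp only [logGammaIncrementFactor, id, Pi.div_apply, Nat.cast_ofNat, Nat.reduceSub, pow_one]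
  field_simp
  ring

/-- The perturbation `δ = -1/1000` is large enough to dominate `u ^ 3 / 6` up to `u = 1/32`. -/
theorem logGammaIncrementFactor_nonneg {a u : ℝ} (ha : 98 / 100 < a) (ha1 : a < 1) (hu : 0 ≤ u)
    (hu' : u ≤ 1 / 32) : 0 ≤ logGammaIncrementFactor a (-(1 / 1000)) u := by
  -- In terms of `c = 1 - a < 1/50` each coefficient in `u` is a small perturbation of a constant.
  obtain ⟨c, rfl⟩ : ∃ c, a = 1 - c := ⟨1 - a, by ring⟩
  have hc0 : 0 < c := by linarith
  have hc1 : c < 1 / 50 := by linarith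
  have c2 : c ^ 2 ≤ 1 / 50 * c := by nlinarith
  have c3 : c ^ 3 ≤ 1 / 50 * c := by nlinarith [pow_pos hc0 2]
  have c2' : 0 < c ^ 2 := by positivity
  have c3' : 0 < c ^ 3 := by positivity
  have u2 : u ^ 2 ≤ 1 / 32 * u := by nlinarith
  have u3 : u ^ 3 ≤ 1 / 32 * u := by nlinarith [sq_nonneg u]
  have u4 : u ^ 4 ≤ 1 / 32 * u := by nlinarith [sq_nonneg u, pow_nonneg hu 3]
  have e : logGammaIncrementFactor (1 - c) (-(1 / 1000)) u = u ^ 2 * (12 / 1000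
      + u * (-1 / 6 - c / 6 - 12 / 1000 * c + 3 / 2 * c ^ 2 - c ^ 3 + 30 / 1000)
      + u ^ 2 * (-1 / 3 - 2 / 3 * c - 18 / 1000 * c + 8 / 3 * c ^ 2 - 3 / 2 * c ^ 3 + 30 / 1000)
      + u ^ 3 * (-1 / 6 - 3 / 4 * c - 12 / 1000 * c + 23 / 12 * c ^ 2 - c ^ 3 + 15 / 1000)
      + u ^ 4 * (-1 / 4 * c - 3 / 1000 * c + 1 / 2 * c ^ 2 - 1 / 4 * c ^ 3 + 3 / 1000)) := by
    unfold logGammaIncrementFactor; ring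
  have k1 : -1 / 5 ≤ -1 / 6 - c / 6 - 12 / 1000 * c + 3 / 2 * c ^ 2 - c ^ 3 + 30 / 1000 := by
    linarith
  have k2 : -1 / 2 ≤ -1 / 3 - 2 / 3 * c - 18 / 1000 * c + 8 / 3 * c ^ 2 - 3 / 2 * c ^ 3
      + 30 / 1000 := by linarith
  have k3 : -1 / 2 ≤ -1 / 6 - 3 / 4 * c - 12 / 1000 * c + 23 / 12 * c ^ 2 - c ^ 3
      + 15 / 1000 := by linarith
  have k4 : -1 / 2 ≤ -1 / 4 * c - 3 / 1000 * c + 1 / 2 * c ^ 2 - 1 / 4 * c ^ 3 + 3 / 1000 := by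
    linarith
  rw [e]
  refine mul_nonneg (sq_nonneg u) ?_
  have m1 := mul_le_mul_of_nonneg_left k1 hu
  have m2 := mul_le_mul_of_nonneg_left k2 (pow_nonneg hu 2)
  have m3 := mul_le_mul_of_nonneg_left k3 (pow_nonneg hu 3)
  have m4 := mul_le_mul_of_nonneg_left k4 (pow_nonneg hu 4)
  linarith

theorem logGammaIncrementFactor_nonpos {a u : ℝ} (ha : 98 / 100 < a) (ha1 : a < 1) (hu : 0 ≤ u) :
    logGammaIncrementFactor a 0 u ≤ 0 := by
  obtain ⟨c, rfl⟩ : ∃ c, a = 1 - c := ⟨1 - a, by ring⟩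
  have hc0 : 0 < c := by linarith
  have hc1 : c < 1 / 50 := by linarith
  have c2 : c ^ 2 ≤ 1 / 50 * c := by nlinarith
  have c3' : 0 < c ^ 3 := by positivity
  have e : logGammaIncrementFactor (1 - c) 0 u = -(u ^ 3 *
      ((1 / 6 + c / 6 - 3 / 2 * c ^ 2 + c ^ 3)
      + u * (1 / 3 + 2 / 3 * c - 8 / 3 * c ^ 2 + 3 / 2 * c ^ 3)
      + u ^ 2 * (1 / 6 + 3 / 4 * c - 23 / 12 * c ^ 2 + c ^ 3)
      + u ^ 3 * (1 / 4 * c - 1 / 2 * c ^ 2 + 1 / 4 * c ^ 3))) := by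
    unfold logGammaIncrementFactor; ring
  have k1 : 0 ≤ 1 / 6 + c / 6 - 3 / 2 * c ^ 2 + c ^ 3 := by linarith
  have k2 : 0 ≤ 1 / 3 + 2 / 3 * c - 8 / 3 * c ^ 2 + 3 / 2 * c ^ 3 := by linarith
  have k3 : 0 ≤ 1 / 6 + 3 / 4 * c - 23 / 12 * c ^ 2 + c ^ 3 := by linarith
  have k4 : 0 ≤ 1 / 4 * c - 1 / 2 * c ^ 2 + 1 / 4 * c ^ 3 := by linarith
  rw [e, neg_nonpos]
  positivity

theorem logGammaIncrement_zero (a δ : ℝ) : logGammaIncrement a δ 0 = 0 := by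
  simp [logGammaIncrement]

theorem logGammaIncrement_nonneg {a u : ℝ} (ha : 98 / 100 < a) (ha1 : a < 1) (hu : 0 ≤ u)
    (hu' : u ≤ 1 / 32) : 0 ≤ logGammaIncrement a (-(1 / 1000)) u := by
  have ha0 : 0 < a := by linarith
  have hm : MonotoneOn (logGammaIncrement a (-(1 / 1000))) (Icc 0 (1 / 32)) := by
    refine monotoneOn_of_hasDerivWithinAt_nonneg (convex_Icc _ _)
      (fun v hv => (hasDerivAt_logGammaIncrement ha0 hv.1).continuousAt.continuousWithinAt)
      (fun v hv => (hasDerivAt_logGammaIncrement ha0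
        (interior_subset hv).1).hasDerivWithinAt) fun v hv => ?_
    have hv := interior_subset hv
    have h := logGammaIncrementFactor_nonneg ha ha1 hv.1 hv.2
    have := hv.1
    have : 0 < 1 - a := by linarith
    positivity
  simpa [logGammaIncrement_zero] using
    hm (show (0 : ℝ) ∈ Icc (0 : ℝ) (1 / 32) by norm_num) ⟨hu, hu'⟩ hu

theorem logGammaIncrement_nonpos {a u : ℝ} (ha : 98 / 100 < a) (ha1 : a < 1) (hu : 0 ≤ u) :
    logGammaIncrement a 0 u ≤ 0 := by
  have ha0 : 0 < a := by linarith
  have hm : AntitoneOn (logGammaIncrement a 0) (Ici 0) := by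
    refine antitoneOn_of_hasDerivWithinAt_nonpos (convex_Ici _)
      (fun v hv => (hasDerivAt_logGammaIncrement ha0 hv).continuousAt.continuousWithinAt)
      (fun v hv => (hasDerivAt_logGammaIncrement ha0
        (interior_subset hv)).hasDerivWithinAt) fun v hv => ?_
    have hv : 0 ≤ v := interior_subset hv
    have h := logGammaIncrementFactor_nonpos ha ha1 hv
    have : 0 < 1 - a := by linarith
    exact div_nonpos_of_nonpos_of_nonneg (mul_nonpos_of_nonneg_of_nonpos (by positivity) h)
      (by positivity)
  simpa [logGammaIncrement_zero] using hm (self_mem_Ici) hu hu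

/-- The increment of the corrected sequence, by which its monotonicity is read off. -/
theorem logGammaApprox_succ {a : ℝ} (ha : 0 < a) (δ : ℝ) {n : ℕ} (hn : 0 < n) :
    logGammaApprox a (n + 1) + logGammaCorrection a δ (n + 1 : ℕ)
      = logGammaApprox a n + logGammaCorrection a δ n + logGammaIncrement a δ (1 / n) := by
  have hn' : (0 : ℝ) < n := by exact_mod_cast hn
  have e1 : Real.log (1 + 1 / (n : ℝ)) = Real.log (n + 1) - Real.log n := by
    rw [← Real.log_div (by positivity) hn'.ne']; congr 1; field_simp
  have e2 : Real.log (1 + a * (1 / (n : ℝ))) = Real.log (a + n) - Real.log n := by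
    rw [← Real.log_div (by positivity) hn'.ne']; congr 1; field_simp; ring
  have e3 : Real.log ((n + 1).factorial : ℝ) = Real.log (n + 1) + Real.log (n.factorial : ℝ) := by
    rw [Nat.factorial_succ, Nat.cast_mul, Real.log_mul (by positivity) (by positivity)]
    push_cast; rfl
  have e4 : 1 / (n : ℝ) / (1 + 1 / n) = 1 / (n + 1) := by field_simp
  rw [logGammaApprox, logGammaApprox, Finset.sum_range_succ, e3, logGammaIncrement, e1, e2, e4,
    logGammaCorrection, logGammaCorrection]
  push_cast
  simp only [div_pow, one_pow]
  ring

theorem tendsto_logGammaApprox {a : ℝ} (ha : 0 < a) (δ : ℝ) :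
    Filter.Tendsto (fun n : ℕ => logGammaApprox a n + logGammaCorrection a δ n) Filter.atTop
      (nhds (Real.log (Real.Gamma a))) := by
  have hinv : Filter.Tendsto (fun n : ℕ => ((n : ℝ))⁻¹) Filter.atTop (nhds 0) :=
    tendsto_inv_atTop_nhds_zero_nat
  have h1 : Filter.Tendsto (fun n : ℕ => logGammaCorrection a δ n) Filter.atTop (nhds 0) := by
    have h := ((hinv.const_mul (-(1 / 2))).add (((hinv.pow 2).const_mul ((2 * a - 1) / 12)).add
      ((hinv.pow 3).const_mul (a * (1 - a) / 12 + δ)))).const_mul (a * (1 - a))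
    simp only [mul_zero, ne_eq, OfNat.ofNat_ne_zero, not_false_eq_true, zero_pow, add_zero] at h
    refine h.congr fun n => ?_
    rw [logGammaCorrection]
    simp only [div_eq_mul_inv, inv_pow]
    ring
  have h2 : Filter.Tendsto (fun n : ℕ => Real.log (1 + a * (n : ℝ)⁻¹)) Filter.atTop (nhds 0) := by
    have h := ((hinv.const_mul a).const_add 1)
    rw [mul_zero, add_zero] at h
    simpa using h.log one_ne_zero
  have h3 := ((Real.BohrMollerup.tendsto_log_gamma ha).add h2).add h1
  simp only [add_zero] at h3
  refine h3.congr' ?_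
  filter_upwards [Filter.eventually_gt_atTop 0] with n hn
  have hn' : (0 : ℝ) < n := by exact_mod_cast hn
  have e2 : Real.log (1 + a * (n : ℝ)⁻¹) = Real.log (a + n) - Real.log n := by
    rw [← Real.log_div (by positivity) hn'.ne']; congr 1; field_simp; ring
  rw [e2, Real.BohrMollerup.logGammaSeq, Finset.sum_range_succ, logGammaApprox]
  ring

/-- With `δ = -1/1000` the corrected sequence increases to `log Γ(a)` from `n = 32` on. -/
theorem logGammaApprox_add_correction_le {a : ℝ} (ha : 98 / 100 < a) (ha1 : a < 1) :
    logGammaApprox a 32 + logGammaCorrection a (-(1 / 1000)) 32 ≤ Real.log (Real.Gamma a) := by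
  have ha0 : 0 < a := by linarith
  have hm : Monotone fun n : ℕ =>
      logGammaApprox a (n + 32) + logGammaCorrection a (-(1 / 1000)) (n + 32 : ℕ) := by
    refine monotone_nat_of_le_succ fun n => ?_
    have h := logGammaApprox_succ ha0 (-(1 / 1000)) (show 0 < n + 32 by lia)
    rw [show n + 1 + 32 = n + 32 + 1 by ring, h, le_add_iff_nonneg_right]
    refine logGammaIncrement_nonneg ha ha1 (by positivity) ?_
    gcongr
    push_cast
    linarith [Nat.cast_nonneg (α := ℝ) n]
  simpa using hm.ge_of_tendsto ((Filter.tendsto_add_atTop_iff_nat 32).2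
    (tendsto_logGammaApprox ha0 (-(1 / 1000)))) 0

/-- With the unperturbed expansion (`δ = 0`) the corrected sequence decreases to `log Γ(a)`. -/
theorem le_logGammaApprox_add_correction {a : ℝ} (ha : 98 / 100 < a) (ha1 : a < 1) :
    Real.log (Real.Gamma a) ≤ logGammaApprox a 32 + logGammaCorrection a 0 32 := by
  have ha0 : 0 < a := by linarith
  have hm : Antitone fun n : ℕ =>
      logGammaApprox a (n + 32) + logGammaCorrection a 0 (n + 32 : ℕ) := by
    refine antitone_nat_of_succ_le fun n => ?_
    have h := logGammaApprox_succ ha0 0 (show 0 < n + 32 by lia)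
    rw [show n + 1 + 32 = n + 32 + 1 by ring, h, add_le_iff_nonpos_right]
    exact logGammaIncrement_nonpos ha ha1 (by positivity)
  simpa using hm.le_of_tendsto ((Filter.tendsto_add_atTop_iff_nat 32).2
    (tendsto_logGammaApprox ha0 0)) 0

/-- The choice `n = 32 = 2 ^ 5` reduces `log n` to `log 2`. -/
theorem exp_logGammaApprox {a : ℝ} (ha : 0 < a) (c : ℝ) : Real.exp (logGammaApprox a 32 + c)
    = (Nat.factorial 32) / (∏ m ∈ Finset.range 32, (a + m))
      * Real.exp ((a - 1) * (5 * Real.log 2) + c) := by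
  have h32 : Real.log ((32 : ℕ) : ℝ) = 5 * Real.log 2 := by
    rw [show ((32 : ℕ) : ℝ) = 2 ^ 5 by norm_num, Real.log_pow]; norm_num
  have hp : ∀ m ∈ Finset.range 32, a + (m : ℝ) ≠ 0 := fun m _ => by positivity
  have hP : 0 < ∏ m ∈ Finset.range 32, (a + (m : ℝ)) := Finset.prod_pos fun m _ => by positivity
  have hF : (0 : ℝ) < Nat.factorial 32 := by exact_mod_cast Nat.factorial_pos 32
  rw [logGammaApprox, h32, ← Real.log_prod hp,
    show (a - 1) * (5 * Real.log 2) + Real.log (Nat.factorial 32)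
      - Real.log (∏ m ∈ Finset.range 32, (a + (m : ℝ))) + c
      = Real.log (Nat.factorial 32) - Real.log (∏ m ∈ Finset.range 32, (a + (m : ℝ)))
        + ((a - 1) * (5 * Real.log 2) + c) by ring,
    Real.exp_add, Real.exp_sub, Real.exp_log hF, Real.exp_log hP]

theorem le_Gamma_of_le_exp {a r : ℝ} (ha : 98 / 100 < a) (ha1 : a < 1)
    (h : r ≤ Real.exp ((a - 1) * (5 * Real.log 2) + logGammaCorrection a (-(1 / 1000)) 32)) :
    a * (Nat.factorial 32 / (∏ m ∈ Finset.range 32, (a + m)) * r) ≤ Real.Gamma (a + 1) := by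
  have ha0 : 0 < a := by linarith
  have h1 := Real.exp_le_exp.2 (logGammaApprox_add_correction_le ha ha1)
  rw [Real.exp_log (Real.Gamma_pos_of_pos ha0), exp_logGammaApprox ha0] at h1
  rw [Real.Gamma_add_one ha0.ne']
  have hP : 0 < ∏ m ∈ Finset.range 32, (a + (m : ℝ)) := Finset.prod_pos fun m _ => by positivity
  refine mul_le_mul_of_nonneg_left (le_trans ?_ h1) ha0.le
  exact mul_le_mul_of_nonneg_left h (by positivity)

theorem Gamma_le_of_exp_le {a r : ℝ} (ha : 98 / 100 < a) (ha1 : a < 1)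
    (h : Real.exp ((a - 1) * (5 * Real.log 2) + logGammaCorrection a 0 32) ≤ r) :
    Real.Gamma (a + 1) ≤ a * (Nat.factorial 32 / (∏ m ∈ Finset.range 32, (a + m)) * r) := by
  have ha0 : 0 < a := by linarith
  have h1 := Real.exp_le_exp.2 (le_logGammaApprox_add_correction ha ha1)
  rw [Real.exp_log (Real.Gamma_pos_of_pos ha0), exp_logGammaApprox ha0] at h1
  rw [Real.Gamma_add_one ha0.ne']
  have hP : 0 < ∏ m ∈ Finset.range 32, (a + (m : ℝ)) := Finset.prod_pos fun m _ => by positivity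
  refine mul_le_mul_of_nonneg_left (h1.trans ?_) ha0.le
  exact mul_le_mul_of_nonneg_left h (by positivity)

/-! ### Numerical enclosures -/

/-- The argument is a lower bound for the exponent in `le_Gamma_of_le_exp` at `a = 0.984598`. -/
theorem le_exp_leftEndpoint : (0.9477969210 : ℝ) ≤ Real.exp (-0.0536150179) := by
  have h := Real.exp_bound (x := -0.0536150179) (by norm_num [abs_le]) (n := 7) (by norm_num)
  have h' := (abs_le.1 h).1
  norm_num [Finset.sum_range_succ, Nat.factorial] at h' ⊢
  linarith

/-- The argument is an upper bound for the exponent in `Gamma_le_of_exp_le` at `a = 0.984599`. -/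
theorem exp_rightEndpoint_le : Real.exp (-0.0536115365) ≤ (0.9478002209 : ℝ) := by
  have h := Real.exp_bound (x := -0.0536115365) (by norm_num [abs_le]) (n := 7) (by norm_num)
  have h' := (abs_le.1 h).2
  norm_num [Finset.sum_range_succ, Nat.factorial] at h' ⊢
  linarith

theorem le_Gamma_leftEndpoint : (0.9935856785 : ℝ) ≤ Real.Gamma 1.984598 := by
  have h : (0.9477969210 : ℝ) ≤ Real.exp ((0.984598 - 1) * (5 * Real.log 2)
      + logGammaCorrection 0.984598 (-(1 / 1000)) 32) := by
    refine le_exp_leftEndpoint.trans (Real.exp_le_exp.2 ?_)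
    have := Real.log_two_lt_d9
    norm_num [logGammaCorrection] at this ⊢
    linarith
  have := le_Gamma_of_le_exp (by norm_num) (by norm_num) h
  rw [show (0.984598 : ℝ) + 1 = 1.984598 by norm_num] at this
  refine le_trans ?_ this
  norm_num [Finset.prod_range_succ, Nat.factorial]

theorem Gamma_rightEndpoint_le : Real.Gamma 1.984599 ≤ (0.9935860898 : ℝ) := by
  have h : Real.exp ((0.984599 - 1) * (5 * Real.log 2)
      + logGammaCorrection 0.984599 0 32) ≤ (0.9478002209 : ℝ) := by
    refine (Real.exp_le_exp.2 ?_).trans exp_rightEndpoint_le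
    have := Real.log_two_gt_d9
    norm_num [logGammaCorrection] at this ⊢
    linarith
  have := Gamma_le_of_exp_le (by norm_num) (by norm_num) h
  rw [show (0.984599 : ℝ) + 1 = 1.984599 by norm_num] at this
  refine this.trans ?_
  norm_num [Finset.prod_range_succ, Nat.factorial]

/-- Thirty-five levels of the continued fraction determine it to within `2e-9`. -/
theorem le_kurepaBeta_zero : (0.4036526370 : ℝ) ≤ kurepaBeta 0 := by
  have h := gamma_mul_tricomiFraction_le (s := 2) two_pos 35
  rw [Real.Gamma_two, one_mul] at h
  rw [kurepaBeta_eq, zero_add]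
  refine le_trans ?_ h
  norm_num [tricomiFraction]

theorem kurepaBeta_zero_le : kurepaBeta 0 ≤ (0.4036526385 : ℝ) := by
  have h := le_gamma_mul_tricomiFraction (s := 2) two_pos 35
  rw [Real.Gamma_two, one_mul] at h
  rw [kurepaBeta_eq, zero_add]
  refine h.trans ?_
  norm_num [tricomiFraction]

theorem le_kurepaBeta_leftEndpoint : (0.9935856785 * 0.4057830396 : ℝ) ≤ kurepaBeta (-0.015402) := by
  have h := gamma_mul_tricomiFraction_le (s := 1.984598) (by norm_num) 35
  rw [kurepaBeta_eq, show (-0.015402 + 2 : ℝ) = 1.984598 by norm_num]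
  refine le_trans (mul_le_mul le_Gamma_leftEndpoint ?_ (by norm_num) (Real.Gamma_pos_of_pos
    (by norm_num)).le) h
  norm_num [tricomiFraction]

theorem kurepaBeta_rightEndpoint_le : kurepaBeta (-0.015401) ≤ (0.9935860898 * 0.4057829023 : ℝ) := by
  have h := le_gamma_mul_tricomiFraction (s := 1.984599) (by norm_num) 35
  rw [kurepaBeta_eq, show (-0.015401 + 2 : ℝ) = 1.984599 by norm_num]
  have hf : tricomiFraction 1.984599 1 35 0 ≤ 0.4057829023 := by norm_num [tricomiFraction]
  exact h.trans ((mul_le_mul_of_nonneg_left hf (Real.Gamma_pos_of_pos (by norm_num)).le).trans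
    (mul_le_mul_of_nonneg_right Gamma_rightEndpoint_le (by norm_num)))

/-- From `cos (2y) = 1 - 2 sin² y` and the cubic lower bound for `sin`. -/
theorem cos_le_of_half_angle {y : ℝ} (hy : 0 ≤ y) (hy1 : y ≤ 1) :
    Real.cos (2 * y) ≤ 1 - 2 * (y - y ^ 3 / 6) ^ 2 := by
  have h := Real.sin_ge_sub_cube hy
  have h0 : 0 ≤ y - y ^ 3 / 6 := by nlinarith [mul_nonneg hy (sub_nonneg.2 hy1), sq_nonneg y]
  rw [Real.cos_two_mul, Real.cos_sq']
  nlinarith [mul_self_le_mul_self h0 h]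

/-- Doubling the angle three times from the quadratic bound `1 - y ^ 2 / 2 ≤ cos y`. -/
theorem le_cos_of_double_angle {y b₁ b₂ : ℝ} (h0 : 0 ≤ 1 - y ^ 2 / 2)
    (h1 : b₁ = 2 * (1 - y ^ 2 / 2) ^ 2 - 1) (hb1 : 0 ≤ b₁)
    (h2 : b₂ = 2 * b₁ ^ 2 - 1) (hb2 : 0 ≤ b₂) : 2 * b₂ ^ 2 - 1 ≤ Real.cos (8 * y) := by
  have e0 : 1 - y ^ 2 / 2 ≤ Real.cos y := Real.one_sub_sq_div_two_le_cos
  have e1 : b₁ ≤ Real.cos (2 * y) := by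
    rw [h1, Real.cos_two_mul]; gcongr
  have e2 : b₂ ≤ Real.cos (2 * (2 * y)) := by
    rw [h2, Real.cos_two_mul (2 * y)]; gcongr
  rw [show 8 * y = 2 * (2 * (2 * y)) by ring, Real.cos_two_mul (2 * (2 * y))]
  gcongr

theorem beta_sub_gamma_leftEndpoint_pos : 0 < kurepaBeta (-0.015402) - kurepaGamma (-0.015402) := by
  have hb := le_kurepaBeta_leftEndpoint
  have hC := kurepaBeta_zero_le
  have hC0 : 0 < kurepaBeta 0 := kurepaBeta_pos (by norm_num)
  have hp1 := Real.pi_gt_d20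
  have hp2 := Real.pi_lt_d20
  have hcos : Real.cos (Real.pi * 0.015402) ≤ 0.9988296 := by
    -- `0.0241934049` is just below `0.007701 * π`.
    have h1 := cos_le_of_half_angle (y := 0.0241934049) (by norm_num) (by norm_num)
    have h2 : Real.cos (Real.pi * 0.015402) ≤ Real.cos (2 * 0.0241934049) :=
      Real.cos_le_cos_of_nonneg_of_le_pi (by norm_num) (by linarith) (by linarith)
    refine h2.trans (h1.trans ?_)
    norm_num
  rw [kurepaGamma_eq, mul_neg, Real.cos_neg]
  have h := mul_le_mul_of_nonneg_right hcos hC0.le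
  linarith

theorem beta_sub_gamma_rightEndpoint_neg : kurepaBeta (-0.015401) - kurepaGamma (-0.015401) < 0 := by
  have hb := kurepaBeta_rightEndpoint_le
  have hC := le_kurepaBeta_zero
  have hC0 : 0 < kurepaBeta 0 := kurepaBeta_pos (by norm_num)
  have hp1 := Real.pi_gt_d20
  have hp2 := Real.pi_lt_d20
  have hcos : 0.99882973 ≤ Real.cos (Real.pi * 0.015401) := by
    -- `0.00604795856` is just above `0.015401 * π / 8`.
    have h1 := le_cos_of_double_angle (y := 0.00604795856) (by norm_num) rfl (by norm_num) rfl
      (by norm_num)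
    have h2 : Real.cos (8 * 0.00604795856) ≤ Real.cos (Real.pi * 0.015401) :=
      Real.cos_le_cos_of_nonneg_of_le_pi (by positivity) (by linarith) (by linarith)
    refine le_trans ?_ (h1.trans h2)
    norm_num
  rw [kurepaGamma_eq, mul_neg, Real.cos_neg]
  have h := mul_le_mul_of_nonneg_right hcos hC0.le
  linarith

/-! ### Sign analysis -/

theorem kurepaBeta_zero_lt_kurepaBeta_neg_one : kurepaBeta 0 < kurepaBeta (-1) := by
  have h := kurepaBeta_add_kurepaBeta_add_one (x := -1) (by norm_num)
  norm_num at h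
  linarith [kurepaBeta_zero_le]

theorem kurepaBeta_zero_lt_kurepaBeta_one : kurepaBeta 0 < kurepaBeta 1 := by
  have h := kurepaBeta_add_kurepaBeta_add_one (x := 0) (by norm_num)
  norm_num at h
  linarith [kurepaBeta_zero_le]

/-- By convexity `β` exceeds `β 0` beyond `±1`, since it does so at `±1`. -/
theorem kurepaBeta_zero_lt {x : ℝ} (hx : -2 < x) (h : x ≤ -1 ∨ 1 ≤ x) :
    kurepaBeta 0 < kurepaBeta x := by
  by_contra! hle
  have h0 : (0 : ℝ) ∈ Ioi (-2 : ℝ) := by norm_num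
  rcases h with h | h
  · have := convexOn_kurepaBeta.le_max_of_mem_Icc (show x ∈ Ioi (-2 : ℝ) from hx) h0
      (show (-1 : ℝ) ∈ Icc x 0 from ⟨h, by norm_num⟩)
    rw [max_eq_right hle] at this
    exact this.not_gt kurepaBeta_zero_lt_kurepaBeta_neg_one
  · have := convexOn_kurepaBeta.le_max_of_mem_Icc h0 (show x ∈ Ioi (-2 : ℝ) from hx)
      (show (1 : ℝ) ∈ Icc 0 x from ⟨by norm_num, h⟩)
    rw [max_eq_left hle] at this
    exact this.not_gt kurepaBeta_zero_lt_kurepaBeta_one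

/-- Away from `[-1/2, 1/2]` either `cos (πx) ≤ 0` or `β x > β 0`. -/
theorem beta_sub_gamma_pos_of_half_le_abs {x : ℝ} (hx : -2 < x)
    (h : x ≤ -(1 / 2) ∨ 1 / 2 ≤ x) : 0 < kurepaBeta x - kurepaGamma x := by
  have hC : 0 < kurepaBeta 0 := kurepaBeta_pos (by norm_num)
  have hb := kurepaBeta_pos hx
  rw [kurepaGamma_eq]
  by_cases h1 : x ≤ -1 ∨ 1 ≤ x
  · have h2 := kurepaBeta_zero_lt hx h1
    nlinarith [Real.cos_le_one (Real.pi * x)]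
  · push Not at h1
    have hpi := Real.pi_pos
    have hcos : Real.cos (Real.pi * x) ≤ 0 := by
      rcases h with h | h
      · rw [← Real.cos_neg]
        exact Real.cos_nonpos_of_pi_div_two_le_of_le (by nlinarith) (by nlinarith)
      · exact Real.cos_nonpos_of_pi_div_two_le_of_le (by nlinarith) (by nlinarith)
    nlinarith

theorem beta_sub_gamma_zero : kurepaBeta 0 - kurepaGamma 0 = 0 := by
  rw [kurepaGamma_eq]; simp

theorem exists_root_beta_sub_gamma : ∃ x₁ : ℝ, (-0.015402 < x₁ ∧ x₁ ≤ -0.015401) ∧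
    kurepaBeta x₁ - kurepaGamma x₁ = 0 := by
  have hc : ContinuousOn (fun x => kurepaBeta x - kurepaGamma x) (Icc (-0.015402) (-0.015401)) := by
    refine ContinuousOn.sub ((convexOn_kurepaBeta.continuousOn isOpen_Ioi).mono fun x hx => ?_) ?_
    · have := hx.1
      norm_num at this ⊢
      linarith
    · rw [funext kurepaGamma_eq]
      fun_prop
  obtain ⟨x, hx, h⟩ := intermediate_value_Icc' (by norm_num) hc
    ⟨beta_sub_gamma_rightEndpoint_neg.le, beta_sub_gamma_leftEndpoint_pos.le⟩
  refine ⟨x, ⟨lt_of_le_of_ne hx.1 ?_, hx.2⟩, h⟩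
  rintro rfl
  exact beta_sub_gamma_leftEndpoint_pos.ne' h

/-- A strictly convex function is negative between two of its zeros. -/
theorem StrictConvexOn.neg_of_mem_Ioo {s : Set ℝ} {f : ℝ → ℝ} (hf : StrictConvexOn ℝ s f)
    {a b x : ℝ} (ha : a ∈ s) (hb : b ∈ s) (fa : f a = 0) (fb : f b = 0) (hx : x ∈ Ioo a b) :
    f x < 0 := by
  have h := hf.lt_on_openSegment ha hb (hx.1.trans hx.2).ne
    (by rwa [openSegment_eq_Ioo (hx.1.trans hx.2)])
  simpa [fa, fb] using h

/-- A strictly convex function is positive outside the interval between two of its zeros. -/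
theorem StrictConvexOn.pos_of_notMem_Icc {s : Set ℝ} {f : ℝ → ℝ} (hf : StrictConvexOn ℝ s f)
    {a b x : ℝ} (ha : a ∈ s) (hb : b ∈ s) (hxs : x ∈ s) (hab : a < b) (fa : f a = 0) (fb : f b = 0)
    (hx : x < a ∨ b < x) : 0 < f x := by
  rcases hx with hx | hx
  · have h := hf.lt_on_openSegment hxs hb (hx.trans hab).ne
      (show a ∈ openSegment ℝ x b by rw [openSegment_eq_Ioo (hx.trans hab)]; exact ⟨hx, hab⟩)
    simpa [fa, fb] using h
  · have h := hf.lt_on_openSegment ha hxs (hab.trans hx).ne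
      (show b ∈ openSegment ℝ a x by rw [openSegment_eq_Ioo (hab.trans hx)]; exact ⟨hab, hx⟩)
    simpa [fa, fb] using h

theorem mainTheorem7 :
    (∀ x : ℝ, -2 < x →
      IntegrableOn (betaIntegrand x) (Ioi (0 : ℝ)) ∧
      IntegrableOn (gammaIntegrand x) (Ioi (0 : ℝ)) ∧
      (alternatingKurepa (x : ℂ)).re = kurepaBeta x - kurepaGamma x) ∧
    ∃ x₁ : ℝ, (-0.015402 < x₁ ∧ x₁ ≤ -0.015401) ∧
      (∀ x : ℝ, -2 < x → ((alternatingKurepa (x : ℂ)).re = 0 ↔ x = x₁ ∨ x = 0)) ∧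
      (∀ x ∈ Ioo (-2) x₁ ∪ Ioi (0 : ℝ), 0 < (alternatingKurepa (x : ℂ)).re) ∧
      (∀ x ∈ Ioo x₁ (0 : ℝ), (alternatingKurepa (x : ℂ)).re < 0) := by
  refine ⟨fun x hx => ⟨integrableOn_betaIntegrand hx, integrableOn_gammaIntegrand x,
    re_alternatingKurepa hx⟩, ?_⟩
  obtain ⟨x₁, hx₁, hroot⟩ := exists_root_beta_sub_gamma
  have hlo : -(1 / 2) < x₁ := by have := hx₁.1; norm_num at this ⊢; linarith
  have hneg : x₁ < 0 := by have := hx₁.2; norm_num at this ⊢; linarith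
  have m₁ : x₁ ∈ Icc (-(1 / 2) : ℝ) (1 / 2) := ⟨hlo.le, by linarith⟩
  have m₀ : (0 : ℝ) ∈ Icc (-(1 / 2) : ℝ) (1 / 2) := by norm_num
  have hpos : ∀ x ∈ Ioo (-2) x₁ ∪ Ioi (0 : ℝ), 0 < (alternatingKurepa (x : ℂ)).re := by
    intro x hx
    have hx2 : -2 < x := by
      rcases hx with hx | hx
      · exact hx.1
      · have : 0 < x := hx
        linarith
    rw [re_alternatingKurepa hx2]
    by_cases hh : x ≤ -(1 / 2) ∨ 1 / 2 ≤ x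
    · exact beta_sub_gamma_pos_of_half_le_abs hx2 hh
    · push Not at hh
      exact strictConvexOn_beta_sub_gamma.pos_of_notMem_Icc m₁ m₀ ⟨hh.1.le, hh.2.le⟩ hneg hroot
        beta_sub_gamma_zero (hx.imp (fun h => h.2) id)
  have hlt : ∀ x ∈ Ioo x₁ (0 : ℝ), (alternatingKurepa (x : ℂ)).re < 0 := by
    intro x hx
    rw [re_alternatingKurepa (by linarith [hx.1])]
    exact strictConvexOn_beta_sub_gamma.neg_of_mem_Ioo m₁ m₀ hroot beta_sub_gamma_zero hx
  refine ⟨x₁, hx₁, fun x hx => ⟨fun h => ?_, ?_⟩, hpos, hlt⟩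
  · by_contra! hne
    rcases lt_or_gt_of_ne hne.1 with h1 | h1
    · exact (hpos x (Or.inl ⟨hx, h1⟩)).ne' h
    · rcases lt_or_gt_of_ne hne.2 with h2 | h2
      · exact (hlt x ⟨h1, h2⟩).ne h
      · exact (hpos x (Or.inr h2)).ne' h
  · rintro (rfl | rfl)
    · rw [re_alternatingKurepa hx, hroot]
    · rw [re_alternatingKurepa hx, beta_sub_gamma_zero]
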